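/- Let $(\Omega,\mathcal F,\mathbf P)$ be a probability space carrying two independent processes: a standard Brownian motion $W=(W_t)_{t\ge 0}$ and a fractional Brownian motion $B^H=(B^H_t)_{t\ge 0}$ with Hurst parameter $\tfrac12<H<1$, that is, a centred Gaussian process with almost surely continuous paths and covariance $\mathbf E[B^H_sB^H_t]=\tfrac12\left(s^{2H}+t^{2H}-|t-s|^{2H}\right)$. Let $\xi_t=W_t+B^H_t$ and, for $a>0$ and $v\in\mathbb R$, let $$\eta_a(v)=\inf\{t>0:\ \xi_t+at>v\}\in[0,\infty],\qquad \inf\emptyset=\infty .$$ Then for every $a>0$ and every integer $n\ge 1$: for each $v>0$, $\eta_a(v)$ is almost surely finite and belongs to $L^n(\Omega)$; $$\lim_{v\to\infty}\mathbf E\left[\eta_a(v)^n\right]\left(\frac{v}{\sqrt2}\right)^{-n}=\left(\frac{a}{\sqrt2}\right)^{-n};$$ and $\eta_a(v)\left(\frac{v}{\sqrt2}\right)^{-1}\to\left(\frac{a}{\sqrt2}\right)^{-1}$ in $L^n(\Omega)$ as $v\to\infty$, i.e. $$\lim_{v\to\infty}\int_\Omega\left|\eta_a(v)\left(\frac{v}{\sqrt2}\right)^{-1}-\left(\frac{a}{\sqrt2}\right)^{-1}\right|^n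 d\mathbf P=0 .$$ -/

import Mathlib

open MeasureTheory ProbabilityTheory Filter Topology
open scoped ENNReal NNReal

/-- A real process `B` indexed by `[0, ∞)` is a (standard) fractional Brownian motion with Hurst
parameter `H` under `P`: a centred Gaussian process with covariance
`(s ^ (2H) + t ^ (2H) - |t - s| ^ (2H)) / 2` and almost surely continuous paths. -/
structure IsFractionalBrownian {Ω : Type*} [MeasurableSpace Ω] (H : ℝ) (B : ℝ≥0 → Ω → ℝ)
    (P : Measure Ω) : Prop where
  isGaussianProcess : IsGaussianProcess B P
  integral_eq_zero : ∀ t, ∫ ω, B t ω ∂P = 0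
  covariance_eq : ∀ s t : ℝ≥0, cov[B s, B t; P] =
    ((s : ℝ) ^ (2 * H) + (t : ℝ) ^ (2 * H) - |(t : ℝ) - (s : ℝ)| ^ (2 * H)) / 2
  ae_continuous : ∀ᵐ ω ∂P, Continuous fun t => B t ω

/-- The mixed process `ξ = σ W + B`. -/
def mixedProcess {Ω : Type*} (σ : ℝ) (W B : ℝ≥0 → Ω → ℝ) (t : ℝ≥0) (ω : Ω) : ℝ :=
  σ * W t ω + B t ω

/-- `η_a(v) = inf {t > 0 | ξ_t + a t > v}`, with value `∞` if the level is never exceeded. -/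
noncomputable def passageTime {Ω : Type*} (ξ : ℝ≥0 → Ω → ℝ) (a v : ℝ) (ω : Ω) : ℝ≥0∞ :=
  ⨅ (t : ℝ≥0) (_ : 0 < t ∧ v < ξ t ω + a * (t : ℝ)), (t : ℝ≥0∞)

/-!
The drift wins: `ξ_t` has size `t ^ H` with `H < 1`, which is negligible against `a t`, so the level
`v` is passed at a time close to `v / a`.

All that is used of `ξ = W + B` is collected in `HasPolynomialIncrementTails`: continuous paths from
`0`, and increments over an interval of length `h` with tails of every polynomial order on the scale
`√(h + h ^ (2H))`, which come from the scaling of Gaussian moments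
(`HasPolynomialIncrementTails.of_brownian_add_fractional`). Two estimates follow.

* *Convergence in probability.* If `η_a(v) / v` differs from `1 / a` by `δ`, then `|ξ|` exceeds a
  fixed multiple of `T` somewhere on `[0, T]`, with `T = (1 / a + δ) v`
  (`exists_abs_gt_of_passageTime_deviation`). A chaining argument over dyadic points bounds the
  probability of this event by a constant times `T ^ (4H - 4)`, which tends to `0`
  (`HasPolynomialIncrementTails.measure_exists_abs_gt_le`).
* *Moments.* For `t ≥ 2 v / a`, the event `η_a(v) > t` forces `ξ_t ≤ -a t / 2`, whose probability
  decays faster than any power of `t`. Hence all moments of `η_a(v) / v` are bounded, uniformly in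
  `v ≥ 1` (`HasPolynomialIncrementTails.integrable_passageTime_div_pow`).

Convergence in probability to the constant `1 / a` and bounded moments of every order give
convergence of the expectation of each continuous function of `η_a(v) / v` of polynomial growth
(`tendsto_integral_comp_of_tendsto_measure`); the functions `x ↦ (√2 x) ^ n` and
`x ↦ |√2 x - √2 / a| ^ n` yield the convergence of moments and the convergence in `L^n`.
-/

/-! ### Gaussian tails -/

lemma gaussianReal_real_abs_ge_le (m : ℕ) : ∃ C : ℝ, 0 ≤ C ∧ ∀ (v : ℝ≥0) (c : ℝ), 0 < c →
    (gaussianReal 0 v).real {x | c ≤ |x|} ≤ C * ((v : ℝ) / c ^ 2) ^ m := by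
  refine ⟨∫ x, |x| ^ (2 * m) ∂(gaussianReal 0 1), by positivity, fun v c hc ↦ ?_⟩
  have hint : Integrable (fun x : ℝ ↦ |x| ^ (2 * m)) (gaussianReal 0 1) := by
    rcases Nat.eq_zero_or_pos m with rfl | hm
    · simp
    · simpa using (memLp_id_gaussianReal (μ := 0) (v := 1) ((2 * m : ℕ) : ℝ≥0)).integrable_norm_pow
        (by positivity)
  have hmap : gaussianReal 0 v = (gaussianReal 0 1).map (√v * ·) := by
    rw [gaussianReal_map_const_mul]
    congr 1
    · simp
    · ext; simp
  have hmeas : MeasurableSet {x : ℝ | c ≤ |x|} := measurableSet_le (by fun_prop) (by fun_prop)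
  rw [hmap, map_measureReal_apply (by fun_prop) hmeas]
  have key := mul_meas_ge_le_integral_of_nonneg (μ := gaussianReal 0 1)
    (f := fun x : ℝ ↦ (v : ℝ) ^ m * |x| ^ (2 * m)) (ae_of_all _ fun x ↦ by positivity)
    (hint.const_mul _) (c ^ (2 * m))
  rw [integral_const_mul] at key
  have hset : (√v * ·) ⁻¹' {x : ℝ | c ≤ |x|} ⊆
      {x | c ^ (2 * m) ≤ (v : ℝ) ^ m * |x| ^ (2 * m)} := by
    intro x hx
    simp only [Set.mem_preimage, Set.mem_ofPred_eq, abs_mul, abs_of_nonneg (Real.sqrt_nonneg _)]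
      at hx ⊢
    calc c ^ (2 * m) ≤ (√v * |x|) ^ (2 * m) := by gcongr
      _ = (v : ℝ) ^ m * |x| ^ (2 * m) := by
        rw [mul_pow, pow_mul √(v : ℝ), Real.sq_sqrt v.coe_nonneg]
  have h1 := measureReal_mono (μ := gaussianReal 0 1) hset
  have h2 : 0 < c ^ (2 * m) := by positivity
  rw [div_pow, ← pow_mul, mul_div_assoc', le_div_iff₀ h2]
  nlinarith

lemma measureReal_abs_ge_of_hasLaw {Ω : Type*} [MeasurableSpace Ω] {P : Measure Ω} {X : Ω → ℝ}
    {v : ℝ≥0} (hX : HasLaw X (gaussianReal 0 v) P) (c : ℝ) :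
    P.real {ω | c ≤ |X ω|} = (gaussianReal 0 v).real {x | c ≤ |x|} := by
  rw [← hX.map_eq, map_measureReal_apply_of_aemeasurable hX.aemeasurable
    (measurableSet_le (by fun_prop) (by fun_prop))]
  rfl

/-- The increments of a fractional Brownian motion are stationary: the one over `[s, t]` has law
`N(0, |t - s| ^ (2H))`. -/
lemma IsFractionalBrownian.hasLaw_sub {Ω : Type*} [MeasurableSpace Ω] {P : Measure Ω}
    [IsProbabilityMeasure P] {H : ℝ} {B : ℝ≥0 → Ω → ℝ} (hB : IsFractionalBrownian H B P)
    (hH : 0 < H) (s t : ℝ≥0) :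
    HasLaw (B s - B t) (gaussianReal 0 ((|(s : ℝ) - t| ^ (2 * H)).toNNReal)) P := by
  have hG := hB.isGaussianProcess.hasGaussianLaw_sub (s := s) (t := t)
  have h2 (r : ℝ≥0) : MemLp (B r) 2 P := (hB.isGaussianProcess.hasGaussianLaw_eval r).memLp_two
  refine ⟨hG.aemeasurable, ?_⟩
  rw [hG.map_eq_gaussianReal]
  congr 2
  · simp only [Pi.sub_apply]
    rw [integral_sub ((h2 s).integrable (by norm_num)) ((h2 t).integrable (by norm_num)),
      hB.integral_eq_zero, hB.integral_eq_zero, sub_zero]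
  · rw [variance_sub (h2 s) (h2 t), ← covariance_self (h2 s).aemeasurable,
      ← covariance_self (h2 t).aemeasurable, hB.covariance_eq, hB.covariance_eq, hB.covariance_eq,
      abs_sub_comm (t : ℝ)]
    have h0 : (0 : ℝ) ^ (2 * H) = 0 := Real.zero_rpow (by positivity)
    simp [h0]
    ring

lemma IsFractionalBrownian.eval_zero_ae_eq_zero {Ω : Type*} [MeasurableSpace Ω] {P : Measure Ω}
    [IsProbabilityMeasure P] {H : ℝ} {B : ℝ≥0 → Ω → ℝ} (hB : IsFractionalBrownian H B P)
    (hH : 0 < H) : ∀ᵐ ω ∂P, B 0 ω = 0 := by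
  have hG := hB.isGaussianProcess.hasGaussianLaw_eval 0
  have hvar : Var[B 0; P] = 0 := by
    rw [← covariance_self hG.aemeasurable, hB.covariance_eq]
    simp [Real.zero_rpow (by positivity : 2 * H ≠ 0)]
  have hlaw : HasLaw (B 0) (Measure.dirac 0) P := by
    refine ⟨hG.aemeasurable, ?_⟩
    rw [hG.map_eq_gaussianReal, hB.integral_eq_zero, hvar]
    simp
  exact hlaw.ae_eq_of_dirac

/-- The properties of a process `ξ` from which the asymptotics of its passage times follow: paths
starting at `0` and continuous, and increments over an interval of length `h` whose tails decay
at every polynomial rate on the scale `√(h + h ^ (2H))`. -/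
structure HasPolynomialIncrementTails {Ω : Type*} [MeasurableSpace Ω] (H : ℝ) (ξ : ℝ≥0 → Ω → ℝ)
    (P : Measure Ω) : Prop where
  aemeasurable : ∀ t, AEMeasurable (ξ t) P
  ae_zero : ∀ᵐ ω ∂P, ξ 0 ω = 0
  ae_continuous : ∀ᵐ ω ∂P, Continuous fun t ↦ ξ t ω
  tail : ∀ m : ℕ, ∃ C : ℝ, 0 ≤ C ∧ ∀ (s t : ℝ≥0) (c : ℝ), 0 < c →
    P.real {ω | c ≤ |ξ s ω - ξ t ω|} ≤
      C * ((|(s : ℝ) - t| + |(s : ℝ) - t| ^ (2 * H)) / c ^ 2) ^ m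

/-- A large increment of the sum forces a large increment of one of the two summands, so the tails
of the two Gaussian increments simply add up. -/
lemma HasPolynomialIncrementTails.of_brownian_add_fractional {Ω : Type*} [MeasurableSpace Ω] {P : Measure Ω}
    [IsProbabilityMeasure P] {W B : ℝ≥0 → Ω → ℝ} {H : ℝ} (hH : 0 < H) (hW : IsBrownianReal W P)
    (hB : IsFractionalBrownian H B P) : HasPolynomialIncrementTails H (mixedProcess 1 W B) P where
  aemeasurable t := by
    have h1 := hW.toIsPreBrownianReal.aemeasurable t
    have h2 := hB.isGaussianProcess.aemeasurable t
    unfold mixedProcess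
    fun_prop
  ae_zero := by
    filter_upwards [hW.toIsPreBrownianReal.eval_zero_ae_eq_zero, hB.eval_zero_ae_eq_zero hH]
      with ω h1 h2
    simp [mixedProcess, h1, h2]
  ae_continuous := by
    filter_upwards [hW.cont, hB.ae_continuous] with ω h1 h2
    unfold mixedProcess
    fun_prop
  tail m := by
    obtain ⟨C, hC, h⟩ := gaussianReal_real_abs_ge_le m
    refine ⟨2 * C * 4 ^ m, by positivity, fun s t c hc ↦ ?_⟩
    set d := |(s : ℝ) - t| with hd
    have hd0 : 0 ≤ d := abs_nonneg _
    have hWt := measureReal_abs_ge_of_hasLaw (hW.toIsPreBrownianReal.hasLaw_sub s t) (c / 2)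
    have hBt := measureReal_abs_ge_of_hasLaw (hB.hasLaw_sub hH s t) (c / 2)
    have hW1 := h (nndist s.1 t.1) (c / 2) (by positivity)
    have hB1 := h (d ^ (2 * H)).toNNReal (c / 2) (by positivity)
    rw [← hWt] at hW1
    rw [← hBt] at hB1
    simp only [mixedProcess, one_mul]
    have hsub : {ω | c ≤ |W s ω + B s ω - (W t ω + B t ω)|} ⊆
        {ω | c / 2 ≤ |(W s - W t) ω|} ∪ {ω | c / 2 ≤ |(B s - B t) ω|} := by
      intro ω hω
      simp only [Set.mem_ofPred_eq, Set.mem_union, Pi.sub_apply] at hω ⊢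
      by_contra! hcon
      have := abs_add_le (W s ω - W t ω) (B s ω - B t ω)
      have h3 : W s ω + B s ω - (W t ω + B t ω) = W s ω - W t ω + (B s ω - B t ω) := by ring
      rw [h3] at hω
      linarith
    have hdW : ((nndist s.1 t.1 : ℝ≥0) : ℝ) = d := by
      rw [coe_nndist, Real.dist_eq, hd]; rfl
    have hpow : 0 ≤ d ^ (2 * H) := by positivity
    rw [hdW] at hW1
    rw [Real.coe_toNNReal _ hpow] at hB1
    have e1 : (d / (c / 2) ^ 2) ^ m ≤ 4 ^ m * ((d + d ^ (2 * H)) / c ^ 2) ^ m := by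
      rw [← mul_pow]
      gcongr
      rw [div_le_iff₀ (by positivity)]
      field_simp
      linarith
    have e2 : (d ^ (2 * H) / (c / 2) ^ 2) ^ m ≤ 4 ^ m * ((d + d ^ (2 * H)) / c ^ 2) ^ m := by
      rw [← mul_pow]
      gcongr
      rw [div_le_iff₀ (by positivity)]
      field_simp
      linarith
    calc _ ≤ _ := measureReal_mono hsub
      _ ≤ _ := measureReal_union_le _ _
      _ ≤ C * (4 ^ m * ((d + d ^ (2 * H)) / c ^ 2) ^ m)
          + C * (4 ^ m * ((d + d ^ (2 * H)) / c ^ 2) ^ m) := by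
        gcongr
        · exact hW1.trans (by gcongr)
        · exact hB1.trans (by gcongr)
      _ = _ := by ring

/-! ### Dyadic chaining -/

/-- Chaining on the dyadic points of `[0, T]`: the value at the dyadic point `j T / 2 ^ k` is
reached by at most one increment of each level `i ≤ k`. -/
lemma abs_dyadic_le_sum {f : ℝ → ℝ} {T : ℝ} (h0 : f 0 = 0) {b : ℕ → ℝ}
    (hb : ∀ k j : ℕ, j < 2 ^ k → |f ((j + 1) * T / 2 ^ k) - f (j * T / 2 ^ k)| ≤ b k) (k : ℕ) :
    ∀ j : ℕ, j ≤ 2 ^ k → |f (j * T / 2 ^ k)| ≤ ∑ i ∈ Finset.range (k + 1), b i := by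
  have hb0 (k : ℕ) : 0 ≤ b k := (abs_nonneg _).trans (hb k 0 (by positivity))
  induction k with
  | zero =>
    intro j hj
    have h1 := hb 0 0 (by simp)
    simp only [pow_zero] at hj
    interval_cases j
    · simpa [h0] using hb0 0
    · simpa [h0] using h1
  | succ k ih =>
    intro j hj
    rw [Finset.sum_range_succ]
    rw [pow_succ] at hj
    -- an even point belongs to the previous level, an odd one has an even left neighbour
    obtain ⟨i, hi | hi⟩ := Nat.even_or_odd' j
    · have h1 := ih i (by omega)
      have e : (j : ℝ) * T / 2 ^ (k + 1) = i * T / 2 ^ k := by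
        rw [hi]; push_cast; field_simp; ring
      rw [e]
      linarith [hb0 (k + 1)]
    · have h1 := ih i (by omega)
      have h2 := hb (k + 1) (2 * i) (by rw [pow_succ]; omega)
      have e : ((2 * i : ℕ) : ℝ) * T / 2 ^ (k + 1) = i * T / 2 ^ k := by
        push_cast; field_simp; ring
      have e' : (((2 * i : ℕ) : ℝ) + 1) * T / 2 ^ (k + 1) = j * T / 2 ^ (k + 1) := by
        rw [hi]; push_cast; ring
      rw [e, e'] at h2
      have := abs_sub_abs_le_abs_sub (f (j * T / 2 ^ (k + 1))) (f (i * T / 2 ^ k))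
      linarith

lemma abs_le_of_dyadic_increments {f : ℝ → ℝ} {T S : ℝ} (hT : 0 < T) (hf : Continuous f)
    (h0 : f 0 = 0) {b : ℕ → ℝ}
    (hb : ∀ k j : ℕ, j < 2 ^ k → |f ((j + 1) * T / 2 ^ k) - f (j * T / 2 ^ k)| ≤ b k)
    (hS : ∀ k, ∑ i ∈ Finset.range k, b i ≤ S) {t : ℝ} (ht0 : 0 ≤ t) (htT : t ≤ T) :
    |f t| ≤ S := by
  have hpow : Tendsto (fun k : ℕ ↦ (2 : ℝ) ^ k) atTop atTop :=
    tendsto_pow_atTop_atTop_of_one_lt (by norm_num)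
  have hlim : Tendsto (fun k : ℕ ↦ (⌊t / T * 2 ^ k⌋₊ : ℝ) * T / 2 ^ k) atTop (𝓝 t) := by
    have h1 := ((tendsto_nat_floor_mul_div_atTop (R := ℝ) (a := t / T) (by positivity)).comp
      hpow).mul_const T
    rw [div_mul_cancel₀ t hT.ne'] at h1
    exact h1.congr fun k ↦ by simp only [Function.comp]; ring
  refine le_of_tendsto ((hf.abs.tendsto t).comp hlim) (Eventually.of_forall fun k ↦ ?_)
  refine (abs_dyadic_le_sum h0 hb k _ ?_).trans (hS _)
  refine Nat.floor_le_of_le ?_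
  push_cast
  have : t / T ≤ 1 := (div_le_one hT).2 htT
  nlinarith [pow_pos (two_pos : (0 : ℝ) < 2) k]

/-! ### A maximal inequality -/

/-- On `[0, T]` with `T ≥ 1`, the process exceeds `ε T` with probability `O(T ^ (4H - 4))`. The
level `ε T` is split into the geometric sum of `ε T / 10 * (9 / 10) ^ k`, and the `2 ^ k` dyadic
increments of level `k` are bounded by their fourth-order tails; as `2 * (9 / 10) ^ 4 > 1`, the
resulting series converges. -/
lemma HasPolynomialIncrementTails.measure_exists_abs_gt_le {Ω : Type*} [MeasurableSpace Ω]
    {P : Measure Ω} [IsProbabilityMeasure P] {H : ℝ} {ξ : ℝ≥0 → Ω → ℝ}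
    (hξ : HasPolynomialIncrementTails H ξ P) (hH : 1 / 2 ≤ H) {ε : ℝ} (hε : 0 < ε) :
    ∃ K : ℝ, ∀ T : ℝ, 1 ≤ T →
      P {ω | ∃ t : ℝ≥0, (t : ℝ) ≤ T ∧ ε * T < |ξ t ω|} ≤
        ENNReal.ofReal (K * (T ^ (2 * H - 2)) ^ 2) := by
  obtain ⟨C, hC, hC2⟩ := hξ.tail 2
  set q : ℝ := 1 / (2 * (9 / 10) ^ 4) with hq
  have hq0 : 0 ≤ q := by positivity
  have hq1 : q < 1 := by norm_num [hq]
  refine ⟨C * (200 / ε ^ 2) ^ 2 * (1 - q)⁻¹, fun T hT ↦ ?_⟩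
  have hT0 : 0 < T := by linarith
  set D : ℝ := C * (200 / ε ^ 2 * T ^ (2 * H - 2)) ^ 2 with hD
  have hD0 : 0 ≤ D := by positivity
  set b : ℕ → ℝ := fun k ↦ ε * T / 10 * (9 / 10) ^ k with hb
  have hb0 (k : ℕ) : 0 < b k := by positivity
  let p (k j : ℕ) : ℝ≥0 := (j * T / 2 ^ k).toNNReal
  have hp (k j : ℕ) : (p k j : ℝ) = j * T / 2 ^ k := Real.coe_toNNReal _ (by positivity)
  let E (k j : ℕ) : Set Ω := {ω | b k ≤ |ξ (p k (j + 1)) ω - ξ (p k j) ω|}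
  -- the variance of an increment of level `k` is at most `2 ^ (-k) * 2 T ^ (2H)`
  have hE (k j : ℕ) : P.real (E k j) ≤ D * (1 / (4 * (9 / 10) ^ 4)) ^ k := by
    have h1 := hC2 (p k (j + 1)) (p k j) (b k) (hb0 k)
    have e1 : |(p k (j + 1) : ℝ) - p k j| = T / 2 ^ k := by
      rw [hp, hp]
      have : ((j + 1 : ℕ) : ℝ) * T / 2 ^ k - j * T / 2 ^ k = T / 2 ^ k := by push_cast; ring
      rw [this, abs_of_nonneg (by positivity)]
    have hTH : T ^ (2 * H) = T ^ (2 * H - 2) * T ^ 2 := by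
      rw [← Real.rpow_natCast T 2, ← Real.rpow_add hT0]; congr 1; push_cast; ring
    have e2 : T / 2 ^ k + (T / 2 ^ k) ^ (2 * H) ≤ 2 * T ^ (2 * H) / 2 ^ k := by
      have a1 : T ≤ T ^ (2 * H) := by
        simpa using Real.rpow_le_rpow_of_exponent_le hT (by linarith : (1 : ℝ) ≤ 2 * H)
      have a2 : (1 / 2 ^ k : ℝ) ^ (2 * H) ≤ 1 / 2 ^ k := by
        have : (1 / 2 ^ k : ℝ) ≤ 1 := by
          rw [div_le_one (by positivity)]; exact one_le_pow₀ (by norm_num)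
        simpa using Real.rpow_le_rpow_of_exponent_ge (by positivity) this
          (by linarith : (1 : ℝ) ≤ 2 * H)
      have a3 : (T / 2 ^ k) ^ (2 * H) = T ^ (2 * H) * (1 / 2 ^ k) ^ (2 * H) := by
        rw [← Real.mul_rpow hT0.le (by positivity)]; congr 1; ring
      rw [a3]
      calc T / 2 ^ k + T ^ (2 * H) * (1 / 2 ^ k) ^ (2 * H)
          ≤ T ^ (2 * H) / 2 ^ k + T ^ (2 * H) * (1 / 2 ^ k) := by gcongr
        _ = _ := by ring
    rw [e1] at h1
    refine h1.trans ?_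
    calc C * ((T / 2 ^ k + (T / 2 ^ k) ^ (2 * H)) / b k ^ 2) ^ 2
        ≤ C * ((2 * T ^ (2 * H) / 2 ^ k) / b k ^ 2) ^ 2 := by gcongr
      _ = D * (1 / (4 * (9 / 10) ^ 4)) ^ k := by
        have e4 : (4 : ℝ) ^ k = 2 ^ k * 2 ^ k := by rw [← mul_pow]; norm_num
        have e9 : (((9 : ℝ) / 10) ^ 4) ^ k = ((9 / 10) ^ k) ^ 4 := by
          rw [← pow_mul, ← pow_mul, mul_comm]
        have hbk : b k = ε * T / 10 * (9 / 10) ^ k := rfl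
        rw [hD, hbk, hTH, div_pow 1 _ k, mul_pow 4 _ k, e4, e9, one_pow]
        have : (0 : ℝ) < (9 / 10) ^ k := by positivity
        generalize ((9 : ℝ) / 10) ^ k = r at *
        field_simp
        ring
  have hsum (k : ℕ) : ∑ i ∈ Finset.range k, b i ≤ ε * T := by
    rw [hb, ← Finset.mul_sum, geom_sum_eq (by norm_num)]
    have : (0 : ℝ) ≤ (9 / 10) ^ k := by positivity
    have h2 : 0 < ε * T := by positivity
    have h3 : (((9 : ℝ) / 10) ^ k - 1) / (9 / 10 - 1) = 10 * (1 - (9 / 10) ^ k) := by ring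
    rw [h3]
    nlinarith
  have hae : ∀ᵐ ω ∂P, ω ∈ {ω | ∃ t : ℝ≥0, (t : ℝ) ≤ T ∧ ε * T < |ξ t ω|} →
      ω ∈ ⋃ k, ⋃ j ∈ Finset.range (2 ^ k), E k j := by
    filter_upwards [hξ.ae_zero, hξ.ae_continuous] with ω hω0 hωc
    rintro ⟨t, htT, ht⟩
    by_contra hcon
    simp only [Set.mem_iUnion, not_exists, Finset.mem_range] at hcon
    refine ht.not_ge ?_
    have key := abs_le_of_dyadic_increments (f := fun x ↦ ξ x.toNNReal ω) (b := b) hT0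
      (hωc.comp continuous_real_toNNReal) (by simpa using hω0) (fun k j hj ↦ ?_) hsum t.2 htT
    · simpa using key
    · have := hcon k j hj
      simp only [E, p, Set.mem_ofPred_eq, not_le] at this
      push_cast at this
      exact this.le
  calc P {ω | ∃ t : ℝ≥0, (t : ℝ) ≤ T ∧ ε * T < |ξ t ω|}
      ≤ P (⋃ k, ⋃ j ∈ Finset.range (2 ^ k), E k j) := measure_mono_ae hae
    _ ≤ ∑' k, P (⋃ j ∈ Finset.range (2 ^ k), E k j) := measure_iUnion_le _
    _ ≤ ∑' k, ENNReal.ofReal (D * q ^ k) := by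
      refine ENNReal.tsum_le_tsum fun k ↦ ?_
      calc P (⋃ j ∈ Finset.range (2 ^ k), E k j)
          ≤ ∑ j ∈ Finset.range (2 ^ k), P (E k j) := measure_biUnion_finset_le _ _
        _ ≤ ∑ j ∈ Finset.range (2 ^ k), ENNReal.ofReal (D * (1 / (4 * (9 / 10) ^ 4)) ^ k) := by
          refine Finset.sum_le_sum fun j _ ↦ ?_
          rw [← ofReal_measureReal]
          exact ENNReal.ofReal_le_ofReal (hE k j)
        _ = ENNReal.ofReal (D * q ^ k) := by
          rw [← ENNReal.ofReal_sum_of_nonneg fun _ _ ↦ by positivity]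
          congr 1
          rw [Finset.sum_const, Finset.card_range, nsmul_eq_mul, mul_left_comm]
          congr 1
          push_cast
          rw [← mul_pow, hq]
          congr 1
          norm_num
    _ = ENNReal.ofReal (D * (1 - q)⁻¹) := by
      rw [← ENNReal.ofReal_tsum_of_nonneg (fun _ ↦ by positivity)
        ((summable_geometric_of_lt_one hq0 hq1).mul_left D), tsum_mul_left,
        tsum_geometric_of_lt_one hq0 hq1]
    _ = _ := by rw [hD]; congr 1; ring

/-! ### Moments from tails, and convergence of moments -/

lemma ENNReal.pow_le_tsum_indicator {p : ℕ} (hp : p ≠ 0) (x : ℝ≥0∞) :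
    x ^ p ≤ ∑' j : ℕ, (Set.Ioi (j : ℝ≥0∞)).indicator (fun _ ↦ ((j : ℝ≥0∞) + 1) ^ p) x := by
  rcases eq_or_ne x ∞ with rfl | hx
  · have h : ∞ = ∑' _ : ℕ, (1 : ℝ≥0∞) := (ENNReal.tsum_const_eq_top_of_ne_zero one_ne_zero).symm
    rw [ENNReal.top_pow hp, h]
    refine ENNReal.tsum_le_tsum fun j ↦ ?_
    rw [Set.indicator_of_mem (by simp)]
    exact one_le_pow₀ (by simp)
  rcases eq_or_ne x 0 with rfl | hx0
  · simp [hp]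
  lift x to ℝ≥0 using hx
  -- the relevant index is `⌈x⌉ - 1`
  obtain ⟨j, hj⟩ : ∃ j, ⌈x⌉₊ = j + 1 :=
    Nat.exists_eq_succ_of_ne_zero (by simpa using hx0)
  have h1 : (j : ℝ≥0) < x := Nat.lt_ceil.1 (by omega)
  have h2 : x ≤ j + 1 := by
    have := Nat.le_ceil x
    rw [hj] at this
    exact_mod_cast this
  refine le_trans ?_ (ENNReal.le_tsum j)
  rw [Set.indicator_of_mem (by simpa using by exact_mod_cast h1)]
  gcongr
  exact_mod_cast h2

lemma lintegral_pow_le_tsum_tail {Ω : Type*} [MeasurableSpace Ω] {P : Measure Ω}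
    {Z : Ω → ℝ≥0∞} (hZ : AEMeasurable Z P) {p : ℕ} (hp : p ≠ 0) :
    ∫⁻ ω, Z ω ^ p ∂P ≤ ∑' j : ℕ, ((j : ℝ≥0∞) + 1) ^ p * P {ω | (j : ℝ≥0∞) < Z ω} := by
  have hset (j : ℕ) : NullMeasurableSet {ω | (j : ℝ≥0∞) < Z ω} P :=
    hZ.nullMeasurable measurableSet_Ioi
  calc ∫⁻ ω, Z ω ^ p ∂P
      ≤ ∫⁻ ω, ∑' j : ℕ, {ω | (j : ℝ≥0∞) < Z ω}.indicator (fun _ ↦ ((j : ℝ≥0∞) + 1) ^ p) ω ∂P :=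
        lintegral_mono fun ω ↦ ENNReal.pow_le_tsum_indicator hp (Z ω)
    _ = _ := by
      rw [lintegral_tsum fun j ↦ aemeasurable_const.indicator₀ (hset j)]
      simp only [lintegral_indicator_const₀ (hset _)]

/-- Convergence in probability to a constant, together with bounded moments of order `p + 1`, gives
convergence of the expectation of every continuous function growing at most like `x ^ p`. -/
lemma tendsto_integral_comp_of_tendsto_measure {Ω : Type*} [MeasurableSpace Ω] {P : Measure Ω}
    [IsProbabilityMeasure P] {ι : Type*} {l : Filter ι} {Z : ι → Ω → ℝ} {c A M : ℝ} {p : ℕ}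
    {g : ℝ → ℝ} (hg : Continuous g) (hgA : ∀ x, 0 ≤ x → |g x| ≤ A * (1 + x ^ p))
    (hZ0 : ∀ i ω, 0 ≤ Z i ω) (hZm : ∀ i, AEMeasurable (Z i) P)
    (hc : ∀ δ : ℝ, 0 < δ → Tendsto (fun i ↦ P {ω | δ ≤ |Z i ω - c|}) l (𝓝 0))
    (hM : ∀ᶠ i in l, Integrable (fun ω ↦ Z i ω ^ (p + 1)) P ∧ ∫ ω, Z i ω ^ (p + 1) ∂P ≤ M) :
    Tendsto (fun i ↦ ∫ ω, g (Z i ω) ∂P) l (𝓝 (g c)) := by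
  have hA : 0 ≤ A := by
    have h1 := (abs_nonneg _).trans (hgA 0 le_rfl)
    have h2 : (0 : ℝ) < 1 + 0 ^ p := by positivity
    exact nonneg_of_mul_nonneg_left h1 h2
  rw [Metric.tendsto_nhds]
  intro ε hε
  obtain ⟨δ, hδ, hδg⟩ := Metric.continuousAt_iff.1 hg.continuousAt (ε / 4) (by positivity)
  set M' : ℝ := max M 0 with hM'
  -- the truncation level, beyond which the bounded moment makes the contribution small
  set R : ℝ := 1 + 4 * A * M' / ε with hR
  have hR1 : 1 ≤ R := by
    have : 0 ≤ 4 * A * M' / ε := by positivity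
    linarith
  set K : ℝ := A * (1 + R ^ p) + A + |g c| + 1 with hK
  have hK0 : 0 < K := by positivity
  have hprob : ∀ᶠ i in l, P.real {ω | δ ≤ |Z i ω - c|} < ε / (4 * K) := by
    have h1 : Tendsto (fun i ↦ P.real {ω | δ ≤ |Z i ω - c|}) l (𝓝 0) := by
      exact (ENNReal.tendsto_toReal ENNReal.zero_ne_top).comp (hc δ hδ)
    exact h1.eventually_lt_const (by positivity)
  filter_upwards [hprob, hM] with i hi ⟨hint, hle⟩
  have hset : NullMeasurableSet {ω | δ ≤ |Z i ω - c|} P :=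
    nullMeasurableSet_le aemeasurable_const ((hZm i).sub_const c).abs
  have hI : Integrable ({ω | δ ≤ |Z i ω - c|}.indicator fun _ ↦ K) P :=
    (integrable_const K).indicator₀ hset
  -- three regimes: near `c`, far from `c` below `R`, above `R`
  have hpt (ω : Ω) : |g (Z i ω) - g c| ≤ ε / 4 + {ω | δ ≤ |Z i ω - c|}.indicator (fun _ ↦ K) ω
      + A / R * Z i ω ^ (p + 1) := by
    have hz := hZ0 i ω
    have hlast : 0 ≤ A / R * Z i ω ^ (p + 1) := by positivity
    by_cases h : δ ≤ |Z i ω - c|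
    · have hmem : ω ∈ {ω | δ ≤ |Z i ω - c|} := h
      rw [Set.indicator_of_mem hmem]
      have h1 := hgA _ hz
      have h2 := abs_sub (g (Z i ω)) (g c)
      have h3 : A * (1 + Z i ω ^ p) ≤ A * (1 + R ^ p) + A + A / R * Z i ω ^ (p + 1) := by
        rcases le_total (Z i ω) R with h4 | h4
        · have : A * (1 + Z i ω ^ p) ≤ A * (1 + R ^ p) := by gcongr
          linarith
        · have : A * Z i ω ^ p ≤ A / R * Z i ω ^ (p + 1) := by
            rw [div_mul_eq_mul_div, le_div_iff₀ (by linarith), pow_succ, ← mul_assoc]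
            gcongr
          have h5 : 0 ≤ A * (1 + R ^ p) := by positivity
          linarith
      linarith
    · have hmem : ω ∉ {ω | δ ≤ |Z i ω - c|} := h
      rw [Set.indicator_of_notMem hmem]
      have := hδg (x := Z i ω) (by rw [Real.dist_eq]; exact not_le.1 h)
      rw [Real.dist_eq] at this
      linarith
  have hbig : Integrable (fun ω ↦ ε / 4 + {ω | δ ≤ |Z i ω - c|}.indicator (fun _ ↦ K) ω
      + A / R * Z i ω ^ (p + 1)) P := ((integrable_const _).add hI).add (hint.const_mul _)
  have hgm : AEStronglyMeasurable (fun ω ↦ g (Z i ω)) P :=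
    (hg.measurable.comp_aemeasurable (hZm i)).aestronglyMeasurable
  have hgc : Integrable (fun ω ↦ g (Z i ω) - g c) P :=
    hbig.mono' (hgm.sub aestronglyMeasurable_const) (ae_of_all _ hpt)
  have hgi : Integrable (fun ω ↦ g (Z i ω)) P := by
    exact (hgc.add (integrable_const (g c))).congr (ae_of_all _ fun ω ↦ by simp)
  have e1 : ∫ ω, g (Z i ω) ∂P - g c = ∫ ω, (g (Z i ω) - g c) ∂P := by
    rw [integral_sub hgi (integrable_const _)]; simp
  rw [Real.dist_eq, e1]
  calc |∫ ω, (g (Z i ω) - g c) ∂P| ≤ ∫ ω, |g (Z i ω) - g c| ∂P := abs_integral_le_integral_abs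
    _ ≤ ∫ ω, (ε / 4 + {ω | δ ≤ |Z i ω - c|}.indicator (fun _ ↦ K) ω
      + A / R * Z i ω ^ (p + 1)) ∂P := integral_mono hgc.abs hbig hpt
    _ = ε / 4 + K * P.real {ω | δ ≤ |Z i ω - c|} + A / R * ∫ ω, Z i ω ^ (p + 1) ∂P := by
      have h1 : Integrable (fun ω ↦ ε / 4 + {ω | δ ≤ |Z i ω - c|}.indicator (fun _ ↦ K) ω) P :=
        (integrable_const _).add hI
      rw [integral_add h1 (hint.const_mul _), integral_add (integrable_const _) hI,
        integral_const_mul, integral_indicator₀ hset]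
      simp [mul_comm]
    _ < ε / 4 + ε / 4 + ε / 4 + ε / 4 := by
      have h1 : K * P.real {ω | δ ≤ |Z i ω - c|} < ε / 4 := by
        rw [lt_div_iff₀ (by positivity)] at hi
        linarith
      have h2 : A / R * ∫ ω, Z i ω ^ (p + 1) ∂P ≤ ε / 4 := by
        have hM0 : 0 ≤ M' := le_max_right _ _
        calc A / R * ∫ ω, Z i ω ^ (p + 1) ∂P ≤ A / R * M' := by
              gcongr; exact hle.trans (le_max_left _ _)
          _ ≤ ε / 4 := by
            rw [div_mul_eq_mul_div, div_le_iff₀ (by linarith), hR]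
            field_simp
            nlinarith
      linarith
    _ = ε := by ring

/-! ### The passage time -/

section PassageTime

variable {Ω : Type*} {ξ : ℝ≥0 → Ω → ℝ} {a v : ℝ} {ω : Ω}

lemma passageTime_le {t : ℝ≥0} (ht : 0 < t) (h : v < ξ t ω + a * t) :
    passageTime ξ a v ω ≤ t :=
  iInf₂_le t ⟨ht, h⟩

lemma passageTime_mono {v' : ℝ} (h : v ≤ v') : passageTime ξ a v ω ≤ passageTime ξ a v' ω :=
  le_iInf₂ fun _ ht ↦ passageTime_le ht.1 (h.trans_lt ht.2)

/-- For a continuous path the infimum may be taken over a countable dense set of times. -/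
lemma passageTime_eq_iInf_denseSeq (hc : Continuous fun t ↦ ξ t ω) :
    passageTime ξ a v ω = ⨅ n : ℕ, if v < ξ (TopologicalSpace.denseSeq ℝ≥0 n) ω +
      a * TopologicalSpace.denseSeq ℝ≥0 n ∧ 0 < TopologicalSpace.denseSeq ℝ≥0 n
      then (TopologicalSpace.denseSeq ℝ≥0 n : ℝ≥0∞) else ∞ := by
  apply le_antisymm
  · refine le_iInf fun n ↦ ?_
    split_ifs with h
    · exact passageTime_le h.2 h.1
    · exact le_top
  · refine le_iInf₂ fun t ht ↦ ?_
    refine le_of_forall_gt fun r hr ↦ ?_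
    obtain ⟨r', hr', hr'r⟩ := ENNReal.lt_iff_exists_nnreal_btwn.1 hr
    have hcv : Continuous fun s : ℝ≥0 ↦ ξ s ω + a * (s : ℝ) := by fun_prop
    have hopen : IsOpen ((Set.Ioi 0 ∩ {s : ℝ≥0 | v < ξ s ω + a * (s : ℝ)}) ∩ Set.Iio r') :=
      (isOpen_Ioi.inter (isOpen_lt continuous_const hcv)).inter isOpen_Iio
    obtain ⟨n, hn⟩ := (TopologicalSpace.denseRange_denseSeq ℝ≥0).exists_mem_open hopen
      ⟨t, ht, by exact_mod_cast hr'⟩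
    refine (iInf_le _ n).trans_lt ?_
    rw [if_pos ⟨hn.1.2, hn.1.1⟩]
    exact lt_trans (by exact_mod_cast hn.2) hr'r

/-- A deviation of `η_a(v) / v` from `1 / a` by `δ` forces `|ξ|` to exceed a multiple of `T` on
`[0, T]`, where `T = (1 / a + δ) v`. -/
lemma exists_abs_gt_of_passageTime_deviation (ha : 0 < a) (hv : 0 < v) {δ : ℝ} (hδ : 0 < δ)
    (hfin : passageTime ξ a v ω < ∞) (h : δ ≤ |(passageTime ξ a v ω).toReal / v - 1 / a|) :
    ∃ t : ℝ≥0, (t : ℝ) ≤ (1 / a + δ) * v ∧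
      a * δ / (4 * (1 / a + δ)) * ((1 / a + δ) * v) < |ξ t ω| := by
  have hs : 0 < 1 / a + δ := by positivity
  have e : a * δ / (4 * (1 / a + δ)) * ((1 / a + δ) * v) = a * δ * v / 4 := by
    field_simp
  rw [e]
  have hpos : 0 < a * δ * v := by positivity
  have haa : a * (1 / a) = 1 := by field_simp
  set η := passageTime ξ a v ω with hη
  rcases le_abs.1 h with h1 | h1
  · -- late passage: the level is not exceeded at time `(1 / a + δ / 2) v`
    have h2 : (1 / a + δ) * v ≤ η.toReal := by
      rw [← le_div_iff₀ hv]; linarith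
    set t : ℝ≥0 := ((1 / a + δ / 2) * v).toNNReal with ht
    have htr : (t : ℝ) = (1 / a + δ / 2) * v := Real.coe_toNNReal _ (by positivity)
    have ht0 : (0 : ℝ) < t := by rw [htr]; positivity
    have hδv : 0 < δ * v := by positivity
    refine ⟨t, by rw [htr]; nlinarith, ?_⟩
    have h3 : ¬ v < ξ t ω + a * t := by
      intro hlt
      have h4 := ENNReal.toReal_mono (by simp) (passageTime_le (by exact_mod_cast ht0) hlt)
      rw [← hη, ENNReal.coe_toReal, htr] at h4
      nlinarith
    have h5 : a * t = v + a * δ * v / 2 := by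
      rw [htr]
      linear_combination v * haa
    have := neg_le_abs (ξ t ω)
    linarith
  · -- early passage: the level is exceeded before time `(1 / a - δ / 2) v`
    have h2 : η.toReal < (1 / a - δ / 2) * v := by
      rw [← div_lt_iff₀ hv]; linarith
    have h3 : η < ENNReal.ofReal ((1 / a - δ / 2) * v) :=
      (ENNReal.lt_ofReal_iff_toReal_lt hfin.ne).2 h2
    rw [hη, passageTime] at h3
    simp only [iInf_lt_iff] at h3
    obtain ⟨t, ⟨ht0, ht⟩, htlt⟩ := h3
    have h4 : (t : ℝ) < (1 / a - δ / 2) * v := by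
      have := (ENNReal.lt_ofReal_iff_toReal_lt (by simp)).1 htlt
      simpa using this
    have hδv : 0 < δ * v := by positivity
    refine ⟨t, by nlinarith, ?_⟩
    have h5 : a * t ≤ a * ((1 / a - δ / 2) * v) := by gcongr
    have h6 : a * ((1 / a - δ / 2) * v) = v - a * δ * v / 2 := by
      linear_combination v * haa
    have := le_abs_self (ξ t ω)
    linarith

variable [MeasurableSpace Ω] {P : Measure Ω} {H : ℝ}

lemma HasPolynomialIncrementTails.aemeasurable_passageTime
    (hξ : HasPolynomialIncrementTails H ξ P) (a v : ℝ) :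
    AEMeasurable (passageTime ξ a v) P := by
  have h : AEMeasurable (fun ω ↦ ⨅ n : ℕ, if v < ξ (TopologicalSpace.denseSeq ℝ≥0 n) ω +
      a * TopologicalSpace.denseSeq ℝ≥0 n ∧ 0 < TopologicalSpace.denseSeq ℝ≥0 n
      then (TopologicalSpace.denseSeq ℝ≥0 n : ℝ≥0∞) else ∞) P := by
    refine AEMeasurable.iInf fun n ↦ ?_
    have hg : Measurable fun x : ℝ ↦ if v < x + a * TopologicalSpace.denseSeq ℝ≥0 n ∧
        0 < TopologicalSpace.denseSeq ℝ≥0 n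
        then (TopologicalSpace.denseSeq ℝ≥0 n : ℝ≥0∞) else ∞ := by
      by_cases h : 0 < TopologicalSpace.denseSeq ℝ≥0 n
      · simp only [h, and_true]
        exact Measurable.ite (measurableSet_lt (by fun_prop) (by fun_prop))
          measurable_const measurable_const
      · simp [h]
    exact hg.comp_aemeasurable (hξ.aemeasurable _)
  refine h.congr ?_
  filter_upwards [hξ.ae_continuous] with ω hω
  exact (passageTime_eq_iInf_denseSeq hω).symm

/-- For levels `v ≥ 1`, the rescaled passage time `η_a(v) / v` has polynomial tails of every order,
uniformly in `v`: not having passed `v` at time `t = j v` means `ξ_t ≤ v - a t`, which is at most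
`-a t / 2` once `j ≥ 2 / a`. -/
lemma HasPolynomialIncrementTails.measure_lt_passageTime_div_le [IsProbabilityMeasure P]
    (hξ : HasPolynomialIncrementTails H ξ P) (hH : 1 / 2 ≤ H) (hH' : H < 1) (ha : 0 < a) (p : ℕ) :
    ∃ C : ℝ, ∀ v : ℝ, 1 ≤ v → ∀ j : ℕ,
      P {ω | (j : ℝ≥0∞) < passageTime ξ a v ω / ENNReal.ofReal v} ≤
        ENNReal.ofReal (C / ((j : ℝ) + 1) ^ p) := by
  obtain ⟨m, hm⟩ := exists_nat_gt ((p : ℝ) / (2 - 2 * H))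
  rw [div_lt_iff₀ (by linarith)] at hm
  obtain ⟨C, hC, hC2⟩ := hξ.tail m
  set D : ℝ := C * (8 / a ^ 2) ^ m * 2 ^ p with hD
  have hD0 : 0 ≤ D := by positivity
  obtain ⟨J, hJ⟩ := exists_nat_gt (max (2 / a) 1)
  obtain ⟨hJa, hJ1⟩ := max_lt_iff.1 hJ
  refine ⟨D + (J + 1) ^ p, fun v hv j ↦ ?_⟩
  rcases lt_or_ge j J with hj | hj
  · refine prob_le_one.trans ?_
    rw [ENNReal.one_le_ofReal, le_div_iff₀ (by positivity), one_mul]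
    have : ((j : ℝ) + 1) ^ p ≤ (J + 1) ^ p := by
      have : (j : ℝ) ≤ J := by exact_mod_cast hj.le
      gcongr
    linarith
  have hjJ : (J : ℝ) ≤ j := by exact_mod_cast hj
  have hj1 : (1 : ℝ) ≤ j := by linarith
  have hv0 : 0 < v := by linarith
  set t : ℝ≥0 := (j * v).toNNReal with ht
  have htr : (t : ℝ) = j * v := Real.coe_toNNReal _ (by positivity)
  have htj : (j : ℝ) ≤ t := by rw [htr]; nlinarith
  have ht1 : (1 : ℝ) ≤ t := hj1.trans htj
  have ht0 : (0 : ℝ) < t := by linarith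
  have hte : (t : ℝ≥0∞) = (j : ℝ≥0∞) * ENNReal.ofReal v := by
    rw [← ENNReal.ofReal_natCast, ← ENNReal.ofReal_mul (by positivity)]; rfl
  have hvt : 2 * v ≤ a * t := by
    have h1 : 2 / a ≤ j := by linarith
    rw [div_le_iff₀ ha] at h1
    rw [htr]
    nlinarith
  have htail := hC2 t 0 (a * t / 2) (by positivity)
  have hae : ∀ᵐ ω ∂P, ω ∈ {ω | (j : ℝ≥0∞) < passageTime ξ a v ω / ENNReal.ofReal v} →
      ω ∈ {ω | a * t / 2 ≤ |ξ t ω - ξ 0 ω|} := by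
    filter_upwards [hξ.ae_zero] with ω h0
    intro hω
    rw [ENNReal.lt_div_iff_mul_lt (by simp [hv0]) (by simp), ← hte] at hω
    have h1 : ¬ v < ξ t ω + a * t := fun h ↦
      (passageTime_le (by exact_mod_cast ht0) h).not_gt hω
    rw [h0, sub_zero]
    refine le_trans ?_ (neg_le_abs _)
    linarith
  have hle : P {ω | (j : ℝ≥0∞) < passageTime ξ a v ω / ENNReal.ofReal v} ≤
      P {ω | a * t / 2 ≤ |ξ t ω - ξ 0 ω|} := measure_mono_ae hae
  refine hle.trans ?_
  rw [← ofReal_measureReal]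
  refine ENNReal.ofReal_le_ofReal (htail.trans ?_)
  have e0 : |(t : ℝ) - (0 : ℝ≥0)| = t := by simp
  rw [e0]
  have e1 : (t : ℝ) + (t : ℝ) ^ (2 * H) ≤ 2 * ((t : ℝ) ^ (2 * H - 2) * (t : ℝ) ^ 2) := by
    have h1 : (t : ℝ) ≤ (t : ℝ) ^ (2 * H) := by
      simpa using Real.rpow_le_rpow_of_exponent_le ht1 (by linarith : (1 : ℝ) ≤ 2 * H)
    have h2 : (t : ℝ) ^ (2 * H) = (t : ℝ) ^ (2 * H - 2) * (t : ℝ) ^ 2 := by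
      rw [← Real.rpow_natCast (t : ℝ) 2, ← Real.rpow_add ht0]; congr 1; push_cast; ring
    linarith
  have e2 : (((t : ℝ) + (t : ℝ) ^ (2 * H)) / (a * t / 2) ^ 2) ≤
      8 / a ^ 2 * (t : ℝ) ^ (2 * H - 2) := by
    rw [div_le_iff₀ (by positivity)]
    refine e1.trans (le_of_eq ?_)
    field_simp
    ring
  have e3 : ((t : ℝ) ^ (2 * H - 2)) ^ m ≤ 1 / (j : ℝ) ^ p := by
    calc ((t : ℝ) ^ (2 * H - 2)) ^ m = (t : ℝ) ^ ((2 * H - 2) * m) := by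
          rw [Real.rpow_mul_natCast ht0.le]
      _ ≤ (t : ℝ) ^ (-(p : ℝ)) := Real.rpow_le_rpow_of_exponent_le ht1 (by linarith)
      _ ≤ (j : ℝ) ^ (-(p : ℝ)) :=
        Real.rpow_le_rpow_of_nonpos (by linarith) htj (by simp)
      _ = _ := by rw [Real.rpow_neg (by positivity), Real.rpow_natCast, one_div]
  have e4 : 1 / (j : ℝ) ^ p ≤ 2 ^ p / ((j : ℝ) + 1) ^ p := by
    rw [div_le_div_iff₀ (by positivity) (by positivity), one_mul, ← mul_pow]
    gcongr
    linarith
  calc C * (((t : ℝ) + (t : ℝ) ^ (2 * H)) / (a * t / 2) ^ 2) ^ m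
      ≤ C * (8 / a ^ 2 * (t : ℝ) ^ (2 * H - 2)) ^ m := by gcongr
    _ = C * (8 / a ^ 2) ^ m * ((t : ℝ) ^ (2 * H - 2)) ^ m := by rw [mul_pow]; ring
    _ ≤ C * (8 / a ^ 2) ^ m * (2 ^ p / ((j : ℝ) + 1) ^ p) := by
      gcongr; exact e3.trans e4
    _ = D / ((j : ℝ) + 1) ^ p := by rw [hD]; ring
    _ ≤ (D + (J + 1) ^ p) / ((j : ℝ) + 1) ^ p := by
      gcongr; simp; positivity

lemma HasPolynomialIncrementTails.lintegral_passageTime_div_pow_le [IsProbabilityMeasure P]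
    (hξ : HasPolynomialIncrementTails H ξ P) (hH : 1 / 2 ≤ H) (hH' : H < 1) (ha : 0 < a)
    {p : ℕ} (hp : p ≠ 0) :
    ∃ M : ℝ, ∀ v : ℝ, 1 ≤ v →
      ∫⁻ ω, (passageTime ξ a v ω / ENNReal.ofReal v) ^ p ∂P ≤ ENNReal.ofReal M := by
  obtain ⟨C, hC⟩ := hξ.measure_lt_passageTime_div_le hH hH' ha (p + 2)
  have hC0 : 0 ≤ max C 0 := le_max_right _ _
  refine ⟨∑' j : ℕ, max C 0 * (1 / ((j : ℝ) + 1) ^ 2), fun v hv ↦ ?_⟩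
  refine (lintegral_pow_le_tsum_tail ((hξ.aemeasurable_passageTime a v).div_const _) hp).trans ?_
  have hsum : Summable fun j : ℕ ↦ 1 / ((j : ℝ) + 1) ^ 2 := by
    exact_mod_cast (summable_nat_add_iff 1).2 (Real.summable_one_div_nat_pow.2 one_lt_two)
  rw [ENNReal.ofReal_tsum_of_nonneg (fun _ ↦ by positivity) (hsum.mul_left _)]
  refine ENNReal.tsum_le_tsum fun j ↦ ?_
  calc ((j : ℝ≥0∞) + 1) ^ p * P {ω | (j : ℝ≥0∞) < passageTime ξ a v ω / ENNReal.ofReal v}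
      ≤ ENNReal.ofReal (((j : ℝ) + 1) ^ p) *
          ENNReal.ofReal (max C 0 / ((j : ℝ) + 1) ^ (p + 2)) := by
        gcongr
        · rw [ENNReal.ofReal_pow (by positivity), ENNReal.ofReal_add (by positivity) zero_le_one]
          simp
        · exact (hC v hv j).trans (ENNReal.ofReal_le_ofReal (by gcongr; exact le_max_left _ _))
    _ = _ := by
      rw [← ENNReal.ofReal_mul (by positivity)]
      congr 1
      rw [pow_add]
      field_simp

lemma HasPolynomialIncrementTails.ae_passageTime_lt_top [IsProbabilityMeasure P]
    (hξ : HasPolynomialIncrementTails H ξ P) (hH : 1 / 2 ≤ H) (hH' : H < 1) (ha : 0 < a) (v : ℝ) :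
    ∀ᵐ ω ∂P, passageTime ξ a v ω < ∞ := by
  obtain ⟨M, hM⟩ := hξ.lintegral_passageTime_div_pow_le hH hH' ha one_ne_zero
  have h1 := hM (max v 1) (le_max_right _ _)
  have h2 := ae_lt_top' (((hξ.aemeasurable_passageTime a (max v 1)).div_const
    (ENNReal.ofReal (max v 1))).pow_const 1) (h1.trans_lt ENNReal.ofReal_lt_top).ne
  filter_upwards [h2] with ω hω
  refine (passageTime_mono (le_max_left v 1)).trans_lt ?_
  rw [pow_one] at hω
  by_contra hcon
  rw [not_lt_top_iff] at hcon
  simp [hcon, ENNReal.top_div_of_ne_top] at hω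

/-- The law of large numbers for passage times: `η_a(v) / v → 1 / a` in probability. -/
lemma HasPolynomialIncrementTails.tendsto_measure_passageTime_deviation [IsProbabilityMeasure P]
    (hξ : HasPolynomialIncrementTails H ξ P) (hH : 1 / 2 ≤ H) (hH' : H < 1) (ha : 0 < a)
    {δ : ℝ} (hδ : 0 < δ) :
    Tendsto (fun v : ℝ ↦ P {ω | δ ≤ |(passageTime ξ a v ω).toReal / v - 1 / a|}) atTop (𝓝 0) := by
  have hs : 0 < 1 / a + δ := by positivity
  obtain ⟨K, hK⟩ := hξ.measure_exists_abs_gt_le hH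
    (ε := a * δ / (4 * (1 / a + δ))) (by positivity)
  have hT : Tendsto (fun v : ℝ ↦ (1 / a + δ) * v) atTop atTop :=
    tendsto_id.const_mul_atTop hs
  have hpow : Tendsto (fun T : ℝ ↦ T ^ (2 * H - 2)) atTop (𝓝 0) := by
    simpa [neg_sub] using tendsto_rpow_neg_atTop (by linarith : 0 < 2 - 2 * H)
  have hlim : Tendsto (fun v : ℝ ↦ ENNReal.ofReal (K * (((1 / a + δ) * v) ^ (2 * H - 2)) ^ 2))
      atTop (𝓝 0) := by
    have h1 := ENNReal.tendsto_ofReal (((hpow.comp hT).pow 2).const_mul K)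
    simpa using h1
  refine tendsto_of_tendsto_of_tendsto_of_le_of_le' tendsto_const_nhds hlim
    (Eventually.of_forall fun _ ↦ zero_le) ?_
  filter_upwards [hT.eventually_ge_atTop 1, eventually_gt_atTop 0] with v hv hv0
  refine (measure_mono_ae ?_).trans (hK _ hv)
  filter_upwards [hξ.ae_passageTime_lt_top hH hH' ha v] with ω hfin hω
  exact exists_abs_gt_of_passageTime_deviation ha hv0 hδ hfin hω

lemma HasPolynomialIncrementTails.integrable_passageTime_div_pow [IsProbabilityMeasure P]
    (hξ : HasPolynomialIncrementTails H ξ P) (hH : 1 / 2 ≤ H) (hH' : H < 1) (ha : 0 < a)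
    {p : ℕ} (hp : p ≠ 0) :
    ∃ M : ℝ, ∀ v : ℝ, 1 ≤ v →
      Integrable (fun ω ↦ ((passageTime ξ a v ω).toReal / v) ^ p) P ∧
      ∫ ω, ((passageTime ξ a v ω).toReal / v) ^ p ∂P ≤ M := by
  obtain ⟨M, hM⟩ := hξ.lintegral_passageTime_div_pow_le hH hH' ha hp
  refine ⟨max M 0, fun v hv ↦ ?_⟩
  have hv0 : 0 < v := by linarith
  have hm : AEMeasurable (fun ω ↦ ((passageTime ξ a v ω).toReal / v) ^ p) P :=
    ((hξ.aemeasurable_passageTime a v).ennreal_toReal.div_const v).pow_const p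
  have hnn (ω : Ω) : 0 ≤ ((passageTime ξ a v ω).toReal / v) ^ p := by positivity
  have hle : ∫⁻ ω, ENNReal.ofReal (((passageTime ξ a v ω).toReal / v) ^ p) ∂P ≤
      ENNReal.ofReal (max M 0) := by
    refine (lintegral_mono fun ω ↦ ?_).trans
      ((hM v hv).trans (ENNReal.ofReal_le_ofReal (le_max_left _ _)))
    rw [ENNReal.ofReal_pow (by positivity), ENNReal.ofReal_div_of_pos hv0]
    gcongr
    exact ENNReal.ofReal_toReal_le
  constructor
  · refine ⟨hm.aestronglyMeasurable, ?_⟩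
    rw [hasFiniteIntegral_iff_ofReal (ae_of_all _ hnn)]
    exact hle.trans_lt ENNReal.ofReal_lt_top
  · rw [integral_eq_lintegral_of_nonneg_ae (ae_of_all _ hnn) hm.aestronglyMeasurable]
    exact ENNReal.toReal_le_of_le_ofReal (le_max_right _ _) hle

lemma HasPolynomialIncrementTails.memLp_passageTime [IsProbabilityMeasure P]
    (hξ : HasPolynomialIncrementTails H ξ P) (hH : 1 / 2 ≤ H) (hH' : H < 1) (ha : 0 < a)
    {p : ℕ} (hp : p ≠ 0) (v : ℝ) :
    MemLp (fun ω ↦ (passageTime ξ a v ω).toReal) p P := by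
  obtain ⟨M, hM⟩ := hξ.integrable_passageTime_div_pow hH hH' ha hp
  have hm (w : ℝ) := (hξ.aemeasurable_passageTime a w).ennreal_toReal
  -- passage times increase with the level, so levels below `1` reduce to level `1`
  set w := max v 1 with hw
  have hw0 : 0 < w := by positivity
  have h1 : MemLp (fun ω ↦ (passageTime ξ a w ω).toReal) p P := by
    rw [← integrable_norm_rpow_iff (hm w).aestronglyMeasurable (by simpa using hp) (by simp)]
    refine ((hM w (le_max_right _ _)).1.mul_const (w ^ p)).congr (ae_of_all _ fun ω ↦ ?_)
    simp only [ENNReal.toReal_natCast, Real.rpow_natCast, Real.norm_eq_abs, ENNReal.abs_toReal]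
    rw [← mul_pow, div_mul_cancel₀ _ hw0.ne']
  refine h1.mono (hm v).aestronglyMeasurable ?_
  filter_upwards [hξ.ae_passageTime_lt_top hH hH' ha w] with ω hω
  simp only [Real.norm_eq_abs, ENNReal.abs_toReal]
  exact ENNReal.toReal_mono hω.ne (passageTime_mono (le_max_left _ _))

/-- Rescaled passage times integrate against continuous functions of polynomial growth as their
limit `1 / a` does. -/
lemma HasPolynomialIncrementTails.tendsto_integral_comp_passageTime_div [IsProbabilityMeasure P]
    (hξ : HasPolynomialIncrementTails H ξ P) (hH : 1 / 2 ≤ H) (hH' : H < 1) (ha : 0 < a)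
    {g : ℝ → ℝ} (hg : Continuous g) {A : ℝ} {p : ℕ} (hgA : ∀ x, 0 ≤ x → |g x| ≤ A * (1 + x ^ p)) :
    Tendsto (fun v : ℝ ↦ ∫ ω, g ((passageTime ξ a v ω).toReal / v) ∂P) atTop (𝓝 (g (1 / a))) := by
  obtain ⟨M, hM⟩ := hξ.integrable_passageTime_div_pow hH hH' ha p.succ_ne_zero
  -- the absolute value only serves to have nonnegative variables at negative levels as well
  have key := tendsto_integral_comp_of_tendsto_measure (P := P) (l := atTop)
    (Z := fun v ω ↦ (passageTime ξ a v ω).toReal / |v|) (c := 1 / a) (M := M) hg hgA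
    (fun v ω ↦ by positivity)
    (fun v ↦ (hξ.aemeasurable_passageTime a v).ennreal_toReal.div_const _)
    (fun δ hδ ↦ (hξ.tendsto_measure_passageTime_deviation hH hH' ha hδ).congr' ?_) ?_
  · refine key.congr' ?_
    filter_upwards [eventually_ge_atTop 0] with v hv
    rw [abs_of_nonneg hv]
  · filter_upwards [eventually_ge_atTop 0] with v hv
    rw [abs_of_nonneg hv]
  · filter_upwards [eventually_ge_atTop 1] with v hv
    rw [abs_of_nonneg (by linarith)]
    exact hM v hv

end PassageTime

/-! ### Convergence of the moments and in `L^n` -/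

theorem mainTheorem4 {Ω : Type*} [MeasurableSpace Ω] (P : Measure Ω) [IsProbabilityMeasure P]
    (W B : ℝ≥0 → Ω → ℝ) (H a : ℝ) (n : ℕ)
    (hH : 1 / 2 < H) (hH' : H < 1) (ha : 0 < a) (hn : 1 ≤ n)
    (hW : IsBrownianReal W P) (hB : IsFractionalBrownian H B P)
    (hWB : IndepFun (fun ω t => W t ω) (fun ω t => B t ω) P)
    (η : ℝ → Ω → ℝ≥0∞) (hη : ∀ v, η v = passageTime (mixedProcess 1 W B) a v) :
    -- for every level `v > 0`, the passage time is a.s. finite and belongs to `L^n`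
    (∀ v : ℝ, 0 < v →
      (∀ᵐ ω ∂P, η v ω < ∞) ∧ MemLp (fun ω => (η v ω).toReal) (n : ℝ≥0∞) P) ∧
    -- convergence of the `n`-th moment
    Tendsto (fun v : ℝ => (∫ ω, (η v ω).toReal ^ n ∂P) * (v / √2) ^ (-(n : ℤ))) atTop
      (𝓝 ((a / √2) ^ (-(n : ℤ)))) ∧
    -- convergence in `L^n`
    Tendsto (fun v : ℝ =>
      eLpNorm (fun ω => (η v ω).toReal * (v / √2)⁻¹ - (a / √2)⁻¹) (n : ℝ≥0∞) P) atTop (𝓝 0) ∧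
    Tendsto (fun v : ℝ =>
      ∫ ω, |(η v ω).toReal * (v / √2)⁻¹ - (a / √2)⁻¹| ^ n ∂P) atTop (𝓝 0) := by
  obtain rfl : η = fun v ↦ passageTime (mixedProcess 1 W B) a v := funext hη
  have hξ := HasPolynomialIncrementTails.of_brownian_add_fractional (by linarith) hW hB
  have hn0 : n ≠ 0 := by omega
  have hmem (v : ℝ) := hξ.memLp_passageTime hH.le hH' ha hn0 v
  have h2 : (0 : ℝ) < √2 := by positivity
  have hscale (x v : ℝ) : x * (v / √2)⁻¹ = √2 * (x / v) := by
    rw [inv_div]; ring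
  set c : ℝ := (a / √2)⁻¹ with hc
  have hc0 : 0 < c := by positivity
  have hca : √2 * (1 / a) = c := by rw [hc, inv_div]; ring
  have hmoment : Tendsto (fun v : ℝ ↦
      ∫ ω, |(passageTime (mixedProcess 1 W B) a v ω).toReal * (v / √2)⁻¹ - c| ^ n ∂P)
      atTop (𝓝 0) := by
    have key := hξ.tendsto_integral_comp_passageTime_div hH.le hH' ha
      (g := fun x ↦ |√2 * x - c| ^ n) (by fun_prop) (A := 2 ^ (n - 1) * (√2 ^ n + c ^ n)) (p := n)
      fun x hx ↦ ?_
    · simp only [hca, sub_self, abs_zero, zero_pow hn0] at key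
      simpa only [hscale] using key
    · have h3 : |√2 * x - c| ≤ √2 * x + c := by
        rw [abs_le]; constructor <;> nlinarith [mul_nonneg h2.le hx]
      have h4 : 0 ≤ c ^ n * x ^ n := by positivity
      have h5 : 0 ≤ √2 ^ n := by positivity
      calc |(|√2 * x - c| ^ n)| = |√2 * x - c| ^ n := abs_of_nonneg (by positivity)
        _ ≤ (√2 * x + c) ^ n := by gcongr
        _ ≤ 2 ^ (n - 1) * ((√2 * x) ^ n + c ^ n) := add_pow_le (by positivity) hc0.le n
        _ ≤ 2 ^ (n - 1) * ((√2 ^ n + c ^ n) * (1 + x ^ n)) := by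
          rw [mul_pow]
          gcongr
          nlinarith
        _ = _ := by ring
  refine ⟨fun v _ ↦ ⟨hξ.ae_passageTime_lt_top hH.le hH' ha v, hmem v⟩, ?_, ?_, hmoment⟩
  · have key := hξ.tendsto_integral_comp_passageTime_div hH.le hH' ha
      (g := fun x ↦ (√2 * x) ^ n) (by fun_prop) (A := √2 ^ n) (p := n) fun x hx ↦ ?_
    · have hlim : (a / √2) ^ (-(n : ℤ)) = (√2 * (1 / a)) ^ n := by
        rw [hca, hc, zpow_neg, zpow_natCast, inv_pow]
      rw [hlim]
      refine key.congr fun v ↦ ?_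
      rw [zpow_neg, zpow_natCast, ← inv_pow, ← integral_mul_const]
      simp only [← mul_pow, hscale]
    · rw [abs_of_nonneg (by positivity), mul_pow]
      gcongr
      linarith
  · have hpow : Tendsto (fun x : ℝ ↦ ENNReal.ofReal (x ^ (n : ℝ)⁻¹)) (𝓝 0) (𝓝 0) := by
      have h3 : Tendsto (fun x : ℝ ↦ x ^ (n : ℝ)⁻¹) (𝓝 0) (𝓝 (0 ^ (n : ℝ)⁻¹)) :=
        (Real.continuousAt_rpow_const _ _ (Or.inr (by positivity))).tendsto
      rw [Real.zero_rpow (by positivity)] at h3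
      simpa using ENNReal.tendsto_ofReal h3
    refine (hpow.comp hmoment).congr fun v ↦ ?_
    have hL : MemLp (fun ω ↦ (passageTime (mixedProcess 1 W B) a v ω).toReal * (v / √2)⁻¹ - c)
        (n : ℝ≥0∞) P := ((hmem v).mul_const _).sub (memLp_const c)
    rw [hL.eLpNorm_eq_integral_rpow_norm (by simpa using hn0) (by simp)]
    simp
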